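/- Let $T=\{x,y\}^*$ be the binary rooted tree, with automorphisms acting on the right, and write $g=\langle\!\langle g_x,g_y\rangle\!\rangle\pi$ for the automorphism that maps $xw\mapsto \pi(x)\,w^{g_x}$ and $yw\mapsto \pi(y)\,w^{g_y}$. Let $G$ be the group of automorphisms of $T$ generated by the automorphisms $a$ and $b$ defined recursively by \[a=\langle\!\langle b,1\rangle\!\rangle(x,y),\qquad b=\langle\!\langle a,1\rangle\!\rangle,\] that is, $(xw)^a=y\,w^b$, $(yw)^a=xw$, $(xw)^b=x\,w^a$, $(yw)^b=yw$. Write $[g,h]=g^{-1}h^{-1}gh$. Then $G$ has, with respect to the generators $a,b$, the presentation \[G=\bigl\langle a,b\ \big|\ [[a^p,b^p],b^p],\ [[b^p,a^{2p}],a^{2p}]\ \text{ for all } p=2^n,\ n\ge 0\bigr\rangle,\] and this is a finite $L$-presentation: there are finite sets $Q,R$ of elements of the free group $F$ on $\{a,b\}$ and a finite set $\Phi$ of endomorphisms of $F$ such that the set of relators displayed above equals $Q\cup\bigcup_{\varphi\in\Phi^*}\varphi(R)$, where $\Phi^*$ is the monoid of endomorphisms generated by $\Phi$. Moreover, the Schur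 multiplier $H_2(G,\mathbb Z)$ is a free abelian group of infinite rank. -/

import Mathlib

namespace Basilica

/-- The alphabet `{x, y}`. -/
inductive Letter : Type
  | x : Letter
  | y : Letter

/-- The vertices of the binary rooted tree `T = {x, y}*`: the root is the empty word and the
children of `w` are `w x` and `w y`, so that `u` is an ancestor of `w` iff `u` is a prefix
of `w`. -/
abbrev Vertex : Type := List Letter

/-- Permutations of the vertices of the tree, acting on the right: in `g * h` the permutation
`g` is applied first. Tree automorphisms are those that satisfy `IsTreeAut` below. -/
abbrev RightPerm : Type := (Equiv.Perm Vertex)ᵐᵒᵖ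

/-- The image `v ^ g` of the vertex `v` under `g`. -/
def act (v : Vertex) (g : RightPerm) : Vertex := g.unop v

theorem act_mul (v : Vertex) (g h : RightPerm) : act v (g * h) = act (act v g) h := rfl

/-- `g` is an automorphism of the rooted tree. -/
def IsTreeAut (g : RightPerm) : Prop :=
  ∀ u v : Vertex, (act u g).length = u.length ∧ (act u g <+: act v g ↔ u <+: v)

mutual
/-- `(x w)^a = y (w^b)`, `(y w)^a = x w`. -/
def aFun : Vertex → Vertex
  | [] => []
  | Letter.x :: w => Letter.y :: bFun w
  | Letter.y :: w => Letter.x :: w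
/-- `(x w)^b = x (w^a)`, `(y w)^b = y w`. -/
def bFun : Vertex → Vertex
  | [] => []
  | Letter.x :: w => Letter.x :: aFun w
  | Letter.y :: w => Letter.y :: w
end

mutual
/-- The inverse of `aFun`. -/
def aInv : Vertex → Vertex
  | [] => []
  | Letter.y :: w => Letter.x :: bInv w
  | Letter.x :: w => Letter.y :: w
/-- The inverse of `bFun`. -/
def bInv : Vertex → Vertex
  | [] => []
  | Letter.x :: w => Letter.x :: aInv w
  | Letter.y :: w => Letter.y :: w
end

theorem inv_fun (w : Vertex) : aInv (aFun w) = w ∧ bInv (bFun w) = w := by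
  induction w with
  | nil => simp [aFun, bFun, aInv, bInv]
  | cons l w ih => cases l <;> simp [aFun, bFun, aInv, bInv, ih]

theorem fun_inv (w : Vertex) : aFun (aInv w) = w ∧ bFun (bInv w) = w := by
  induction w with
  | nil => simp [aFun, bFun, aInv, bInv]
  | cons l w ih => cases l <;> simp [aFun, bFun, aInv, bInv, ih]

/-- The tree automorphism `a = ⟨b, 1⟩ (x, y)`. -/
def a : RightPerm :=
  MulOpposite.op ⟨aFun, aInv, fun w => (inv_fun w).1, fun w => (fun_inv w).1⟩

/-- The tree automorphism `b = ⟨a, 1⟩`. -/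
def b : RightPerm :=
  MulOpposite.op ⟨bFun, bInv, fun w => (inv_fun w).2, fun w => (fun_inv w).2⟩

theorem act_a_x (w : Vertex) : act (Letter.x :: w) a = Letter.y :: act w b := rfl

theorem act_a_y (w : Vertex) : act (Letter.y :: w) a = Letter.x :: w := rfl

theorem act_b_x (w : Vertex) : act (Letter.x :: w) b = Letter.x :: act w a := rfl

theorem act_b_y (w : Vertex) : act (Letter.y :: w) b = Letter.y :: w := rfl

theorem isTreeAut_aux (u : Vertex) : ∀ v : Vertex,
    ((aFun u).length = u.length ∧ (aFun u <+: aFun v ↔ u <+: v)) ∧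
    ((bFun u).length = u.length ∧ (bFun u <+: bFun v ↔ u <+: v)) := by
  induction u with
  | nil => intro v; simp [aFun, bFun]
  | cons l u ih =>
    intro v
    cases v with
    | nil => cases l <;> simp [aFun, bFun, (ih []).1.1, (ih []).2.1]
    | cons m v => cases l <;> cases m <;> simp [aFun, bFun, ih v, List.cons_prefix_cons]

theorem isTreeAut_a : IsTreeAut a := fun u v => (isTreeAut_aux u v).1

theorem isTreeAut_b : IsTreeAut b := fun u v => (isTreeAut_aux u v).2

/-- The group `G`, generated by `a` and `b`. -/
def G : Subgroup RightPerm := Subgroup.closure {a, b}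

/-- The generator `a`, as an element of `G`. -/
def genA : G := ⟨a, Subgroup.subset_closure (Or.inl rfl)⟩

/-- The generator `b`, as an element of `G`. -/
def genB : G := ⟨b, Subgroup.subset_closure (Or.inr rfl)⟩

/-- The commutator `[g, h] = g⁻¹ h⁻¹ g h`. -/
def rcomm {H : Type*} [Group H] (g h : H) : H := g⁻¹ * h⁻¹ * g * h

/-- The letter `a` of the free group on two letters. -/
def freeA : FreeGroup (Fin 2) := FreeGroup.of 0

/-- The letter `b` of the free group on two letters. -/
def freeB : FreeGroup (Fin 2) := FreeGroup.of 1

/-- The words `[[a^p, b^p], b^p]` and `[[b^p, a^(2p)], a^(2p)]`, for all powers `p = 2^n`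
of `2`, `n ≥ 0`. -/
def relators : Set (FreeGroup (Fin 2)) :=
  {r | ∃ n p : ℕ, p = 2 ^ n ∧
    (r = rcomm (rcomm (freeA ^ p) (freeB ^ p)) (freeB ^ p) ∨
      r = rcomm (rcomm (freeB ^ p) (freeA ^ (2 * p))) (freeA ^ (2 * p)))}

/-- An `L`-presentation (endomorphic presentation) `⟨S | Q | Φ | R⟩`: sets `Q` and `R` of words
in the free group on `S`, and a set `Φ` of endomorphisms of that free group. -/
structure LPresentation (S : Type) where
  /-- the fixed relators -/
  Q : Set (FreeGroup S)
  /-- the substitutions -/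
  Φ : Set (Monoid.End (FreeGroup S))
  /-- the iterated relators -/
  R : Set (FreeGroup S)

namespace LPresentation

/-- The defining relators of the group presented by `⟨S | Q | Φ | R⟩`: the elements of `Q`, and
all `φ r` with `r ∈ R` and `φ` in the monoid of endomorphisms generated by `Φ`. -/
def relators {S : Type} (L : LPresentation S) : Set (FreeGroup S) :=
  L.Q ∪ {w | ∃ φ ∈ Submonoid.closure L.Φ, ∃ r ∈ L.R, w = φ r}

/-- An `L`-presentation is finite if `S`, `Q`, `Φ` and `R` are finite. -/
def IsFinite {S : Type} (L : LPresentation S) : Prop :=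
  Finite S ∧ L.Q.Finite ∧ L.Φ.Finite ∧ L.R.Finite

end LPresentation

/-- The Schur multiplier `H₂(H, ℤ)`: the second homology group of `H` with coefficients in the
trivial module `ℤ`. -/
noncomputable abbrev SchurMultiplier (H : Type) [Group H] : Type :=
  groupHomology (Rep.trivial ℤ H ℤ) 2

end Basilica

-- Let F be free on a, b, let ψ : F → F ≀ C₂ be the recursion defining the action, and let σ : a ↦
-- b, b ↦ a². The displayed relators are exactly the words σⁿ([[a, b], b]), which gives the finite
-- L-presentation. Let R be their normal closure. Since ψ([[a, b], b]) = 1 and ψ(σ v) = ⟨⟨v, b^e⟩⟩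
-- with e the b-exponent sum of v, ψ maps R into R × R, and all relators act trivially on the tree.
--
-- Conversely, a word acting trivially lies in R. The map F/R → (F/R) ≀ C₂ induced by ψ is injective
-- (`psiGam_injective`): the first two relators make enough conjugates of b commute to give a normal
-- form on which ψ can be read off. A word is therefore in R as soon as both sections are and no
-- swap occurs. The lengths of the two sections add up to that of the word, so induction on length
-- applies unless a section is the empty word; then the word is a power of b or a conjugate of one,
-- and b has infinite order (`mk_mem_relSub`).
--
-- For the multiplier, R ≤ [F, F], so Hopf's formula reads H₂(G) = R/[F, R], which the relators
-- span. Independence is tested by conjugation-invariant homomorphisms R → ℤ. A nilpotent quotient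
-- of class 3 supplies one that is nonzero on the first relator, and adding up the values on the two
-- sections shifts a character one step along the sequence of relators (`exists_char`). The pairing
-- is thus triangular, and the relators form a basis.

namespace Basilica

-- Wreath products with the group of order two.

section Wreath

/-- The wreath product of `H` with the group of order two: `⟨g, h, s⟩` stands for
`⟨⟨g, h⟩⟩ π`, where `π` is the transposition `(x, y)` if `s` is true. -/
@[ext]
structure Wreath (H : Type*) where
  /-- the section at `x` -/
  fst : H
  /-- the section at `y` -/
  snd : H
  /-- whether the two subtrees are exchanged -/
  swap : Bool

namespace Wreath

variable {H H' : Type*} [Group H] [Group H']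

instance : Mul (Wreath H) :=
  ⟨fun g h => ⟨g.fst * cond g.swap h.snd h.fst, g.snd * cond g.swap h.fst h.snd,
    xor g.swap h.swap⟩⟩

instance : One (Wreath H) := ⟨⟨1, 1, false⟩⟩

instance : Inv (Wreath H) :=
  ⟨fun g => ⟨cond g.swap g.snd⁻¹ g.fst⁻¹, cond g.swap g.fst⁻¹ g.snd⁻¹, g.swap⟩⟩

theorem mul_def (g h : Wreath H) :
    g * h = ⟨g.fst * cond g.swap h.snd h.fst, g.snd * cond g.swap h.fst h.snd,
      xor g.swap h.swap⟩ := rfl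

theorem one_def : (1 : Wreath H) = ⟨1, 1, false⟩ := rfl

theorem inv_def (g : Wreath H) :
    g⁻¹ = ⟨cond g.swap g.snd⁻¹ g.fst⁻¹, cond g.swap g.fst⁻¹ g.snd⁻¹, g.swap⟩ := rfl

instance : Group (Wreath H) :=
  Group.ofLeftAxioms
    (by
      rintro ⟨g, g', _ | _⟩ ⟨h, h', _ | _⟩ ⟨k, k', _ | _⟩ <;> simp [mul_def, mul_assoc])
    (by rintro ⟨g, g', s⟩; simp [mul_def, one_def])
    (by rintro ⟨g, g', _ | _⟩ <;> simp [mul_def, one_def, inv_def])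

/-- The map of wreath products that is induced by a group homomorphism. -/
def map (f : H →* H') : Wreath H →* Wreath H' where
  toFun g := ⟨f g.fst, f g.snd, g.swap⟩
  map_one' := by simp [one_def]
  map_mul' := by rintro ⟨g, g', _ | _⟩ ⟨h, h', t⟩ <;> simp [mul_def]

theorem mk_pow (g h : H) (n : ℕ) :
    (⟨g, h, false⟩ : Wreath H) ^ n = ⟨g ^ n, h ^ n, false⟩ := by
  induction n with
  | zero => simp [one_def]
  | succ n ih => simp [pow_succ, ih, mul_def]

theorem mk_zpow (g h : H) (n : ℤ) :
    (⟨g, h, false⟩ : Wreath H) ^ n = ⟨g ^ n, h ^ n, false⟩ := by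
  cases n <;> simp [mk_pow, inv_def]

/-- For a normal subgroup `N` of `H`, the normal subgroup `N × N` of the wreath product. -/
def base (N : Subgroup H) : Subgroup (Wreath H) where
  carrier := {g | g.fst ∈ N ∧ g.snd ∈ N ∧ g.swap = false}
  one_mem' := ⟨N.one_mem, N.one_mem, rfl⟩
  mul_mem' := by
    rintro ⟨g, g', s⟩ ⟨h, h', t⟩ ⟨h1, h2, rfl⟩ ⟨h3, h4, rfl⟩
    exact ⟨N.mul_mem h1 h3, N.mul_mem h2 h4, rfl⟩
  inv_mem' := by
    rintro ⟨g, g', s⟩ ⟨h1, h2, rfl⟩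
    exact ⟨N.inv_mem h1, N.inv_mem h2, rfl⟩

instance (N : Subgroup H) [hN : N.Normal] : (base N).Normal := by
  constructor
  rintro ⟨g, g', s⟩ ⟨h1, h2, rfl⟩ ⟨k, k', _ | _⟩
  · exact ⟨hN.conj_mem _ h1 _, hN.conj_mem _ h2 _, rfl⟩
  · exact ⟨hN.conj_mem _ h2 _, hN.conj_mem _ h1 _, rfl⟩

end Wreath

end Wreath

-- The substitution, the recursion and the relators.

section FreeGroup

variable {H : Type*} [Group H]

/-- The homomorphism from the free group that maps the two letters to `g` and `h`. -/
def liftPair (g h : H) : FreeGroup (Fin 2) →* H := FreeGroup.lift ![g, h]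

@[simp] theorem liftPair_freeA (g h : H) : liftPair g h freeA = g := by
  simp [liftPair, freeA]

@[simp] theorem liftPair_freeB (g h : H) : liftPair g h freeB = h := by
  simp [liftPair, freeB]

theorem hom_ext {f g : FreeGroup (Fin 2) →* H} (ha : f freeA = g freeA)
    (hb : f freeB = g freeB) : f = g := by
  ext j
  fin_cases j
  · exact ha
  · exact hb

theorem free_induction {C : FreeGroup (Fin 2) → Prop} (one : C 1)
    (mul_a : ∀ v, C v → C (v * freeA)) (mul_a_inv : ∀ v, C v → C (v * freeA⁻¹))
    (mul_b : ∀ v, C v → C (v * freeB)) (mul_b_inv : ∀ v, C v → C (v * freeB⁻¹))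
    (v : FreeGroup (Fin 2)) : C v := by
  have h : v ∈ Subgroup.closure (Set.range (FreeGroup.of : Fin 2 → FreeGroup (Fin 2))) := by
    rw [FreeGroup.closure_range_of]; trivial
  induction h using Subgroup.closure_induction_right with
  | one => exact one
  | mul_right x _ y hy hz =>
    obtain ⟨j, rfl⟩ := hy
    fin_cases j
    · exact mul_a _ hz
    · exact mul_b _ hz
  | mul_inv_cancel x _ y hy hz =>
    obtain ⟨j, rfl⟩ := hy
    fin_cases j
    · exact mul_a_inv _ hz
    · exact mul_b_inv _ hz

/-- The substitution `a ↦ b, b ↦ a²`. -/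
def sigma : Monoid.End (FreeGroup (Fin 2)) := liftPair freeB (freeA ^ 2)

@[simp] theorem sigma_freeA : sigma freeA = freeB := liftPair_freeA _ _

@[simp] theorem sigma_freeB : sigma freeB = freeA ^ 2 := liftPair_freeB _ _

/-- The exponent sum of the letter `b`. -/
def expB : FreeGroup (Fin 2) →* Multiplicative ℤ := liftPair 1 (Multiplicative.ofAdd 1)

/-- The recursion `a ↦ ⟨⟨b, 1⟩⟩ (x, y)`, `b ↦ ⟨⟨a, 1⟩⟩` on words. -/
def psi : FreeGroup (Fin 2) →* Wreath (FreeGroup (Fin 2)) :=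
  liftPair ⟨freeB, 1, true⟩ ⟨freeA, 1, false⟩

@[simp] theorem psi_freeA : psi freeA = ⟨freeB, 1, true⟩ := liftPair_freeA _ _

@[simp] theorem psi_freeB : psi freeB = ⟨freeA, 1, false⟩ := liftPair_freeB _ _

theorem map_rcomm {H' F : Type*} [Group H'] [FunLike F H H'] [MonoidHomClass F H H'] (f : F)
    (g h : H) : f (rcomm g h) = rcomm (f g) (f h) := by simp [rcomm]

/-- The relator `[[a, b], b]`. -/
def rel : FreeGroup (Fin 2) := rcomm (rcomm freeA freeB) freeB

theorem psi_rel : psi rel = 1 := by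
  simp [rel, rcomm, Wreath.mul_def, Wreath.inv_def, Wreath.one_def, mul_assoc]

/-- σ is a section of the first coordinate of ψ: b = ⟨⟨a, 1⟩⟩ and a² = ⟨⟨b, b⟩⟩, so only the letters
b of v contribute to the second coordinate. -/
theorem psi_sigma (v : FreeGroup (Fin 2)) :
    psi (sigma v) = ⟨v, freeB ^ (expB v).toAdd, false⟩ := by
  induction v using free_induction with
  | one => simp [Wreath.one_def]
  | mul_a v h => simp [h, expB, Wreath.mul_def]
  | mul_a_inv v h => simp [h, expB, Wreath.mul_def, Wreath.inv_def]
  | mul_b v h => simp [h, expB, Wreath.mul_def, pow_two, zpow_add]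
  | mul_b_inv v h =>
    simp [h, expB, Wreath.mul_def, Wreath.inv_def, pow_two, zpow_add]

/-- σ² squares both letters. Even iterates thus produce the first family of relators and odd
iterates the second. -/
theorem sigma_sigma_pow (n : ℕ) : (sigma ^ (2 * n)) freeA = freeA ^ 2 ^ n ∧
    (sigma ^ (2 * n)) freeB = freeB ^ 2 ^ n := by
  induction n with
  | zero => simp
  | succ n ih =>
    rw [show 2 * (n + 1) = 1 + 1 + 2 * n by ring, pow_add, pow_add, pow_one]
    change sigma (sigma ((sigma ^ (2 * n)) freeA)) = _ ∧
      sigma (sigma ((sigma ^ (2 * n)) freeB)) = _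
    rw [ih.1, ih.2, map_pow, map_pow, map_pow, map_pow, sigma_freeA, sigma_freeB, map_pow,
      sigma_freeA, ← pow_mul, ← pow_mul, pow_succ' 2 n]
    exact ⟨rfl, rfl⟩

/-- The iterated images of `[[a, b], b]` under the substitution. -/
def iterRel (n : ℕ) : FreeGroup (Fin 2) := (sigma ^ n) rel

theorem iterRel_zero : iterRel 0 = rel := rfl

theorem iterRel_succ (n : ℕ) : iterRel (n + 1) = sigma (iterRel n) := by
  simp [iterRel, pow_succ']

theorem iterRel_even (n : ℕ) : iterRel (2 * n) =
    rcomm (rcomm (freeA ^ 2 ^ n) (freeB ^ 2 ^ n)) (freeB ^ 2 ^ n) := by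
  simp [iterRel, rel, map_rcomm, (sigma_sigma_pow n).1, (sigma_sigma_pow n).2]

theorem iterRel_odd (n : ℕ) : iterRel (2 * n + 1) =
    rcomm (rcomm (freeB ^ 2 ^ n) (freeA ^ (2 * 2 ^ n))) (freeA ^ (2 * 2 ^ n)) := by
  simp [iterRel_succ, iterRel_even, map_rcomm, pow_mul]

theorem relators_eq : relators = Set.range iterRel := by
  ext r
  constructor
  · rintro ⟨n, p, rfl, rfl | rfl⟩
    · exact ⟨2 * n, iterRel_even n⟩
    · exact ⟨2 * n + 1, iterRel_odd n⟩
  · rintro ⟨n, rfl⟩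
    obtain ⟨k, rfl | rfl⟩ := n.even_or_odd'
    · exact ⟨k, _, rfl, Or.inl (iterRel_even k)⟩
    · exact ⟨k, _, rfl, Or.inr (iterRel_odd k)⟩

theorem exists_finite_LPresentation :
    ∃ L : LPresentation (Fin 2), L.IsFinite ∧ L.relators = relators := by
  refine ⟨⟨∅, {sigma}, {rel}⟩,
    ⟨inferInstance, Set.finite_empty, Set.finite_singleton _, Set.finite_singleton _⟩, ?_⟩
  ext r
  rw [relators_eq]
  simp only [LPresentation.relators, Set.empty_union, Set.mem_ofPred_eq, Set.mem_range,
    Submonoid.mem_closure_singleton, Set.mem_singleton_iff, exists_eq_left]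
  constructor
  · rintro ⟨_, ⟨n, rfl⟩, rfl⟩
    exact ⟨n, rfl⟩
  · rintro ⟨n, rfl⟩
    exact ⟨_, ⟨n, rfl⟩, rfl⟩

/-- The normal subgroup of the free group that the relators generate. -/
def relSub : Subgroup (FreeGroup (Fin 2)) := Subgroup.normalClosure relators

instance : relSub.Normal := Subgroup.normalClosure_normal

theorem iterRel_mem (n : ℕ) : iterRel n ∈ relSub :=
  Subgroup.subset_normalClosure (relators_eq ▸ ⟨n, rfl⟩)

theorem relSub_le {N : Subgroup (FreeGroup (Fin 2))} [N.Normal] (h : ∀ n, iterRel n ∈ N) :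
    relSub ≤ N := by
  refine Subgroup.normalClosure_le_normal ?_
  rw [relators_eq]
  rintro _ ⟨n, rfl⟩
  exact h n

theorem rcomm_eq_one {A : Type*} [CommGroup A] (g h : A) : rcomm g h = 1 := by
  simp [rcomm, mul_comm]

/-- All relators are commutators. With `f = expB` this kills the second section of σ(r) for r in
`relSub`. -/
theorem hom_eq_one_of_mem {A : Type*} [CommGroup A] (f : FreeGroup (Fin 2) →* A)
    {v : FreeGroup (Fin 2)} (hv : v ∈ relSub) : f v = 1 := by
  refine relSub_le (N := f.ker) (fun n => ?_) hv
  simp [MonoidHom.mem_ker, iterRel, rel, map_rcomm, rcomm_eq_one]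

theorem sigma_mem {v : FreeGroup (Fin 2)} (hv : v ∈ relSub) : sigma v ∈ relSub := by
  let f : FreeGroup (Fin 2) →* FreeGroup (Fin 2) := sigma
  refine relSub_le (N := relSub.comap f) (fun n => ?_) hv
  have h := iterRel_mem (n + 1)
  rwa [iterRel_succ] at h

theorem psi_mem {v : FreeGroup (Fin 2)} (hv : v ∈ relSub) : psi v ∈ Wreath.base relSub := by
  refine relSub_le (N := (Wreath.base relSub).comap psi) (fun n => ?_) hv
  rw [Subgroup.mem_comap]
  cases n with
  | zero => rw [iterRel_zero, psi_rel]; exact one_mem _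
  | succ n =>
    rw [iterRel_succ, psi_sigma, hom_eq_one_of_mem _ (iterRel_mem n)]
    exact ⟨iterRel_mem n, one_mem _, rfl⟩

end FreeGroup

end Basilica

-- Injectivity of the recursion on the presented group.

namespace Basilica

section Commutation

variable {H : Type*} [Group H] {g h : H}

theorem rcomm_eq_one_iff : rcomm g h = 1 ↔ Commute g h := by
  rw [rcomm, mul_assoc, ← mul_inv_rev, inv_mul_eq_one, commute_iff_eq, eq_comm]

/-- Put c m = g^m h g^(-m). By `h₂` the quotient (c (m + 2))⁻¹ c m does not change under m ↦ m - 2,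
so all odd c m arise from c 1 by multiplying with powers of one element (c 1)⁻¹ c (-1). By `h₁`, h
commutes with c (-1), and conjugating by g, with c 1. -/
theorem commute_conj_zpow (h₁ : rcomm (rcomm g h) h = 1)
    (h₂ : rcomm (rcomm h (g ^ 2)) (g ^ 2) = 1) (k : ℤ) :
    Commute h (g ^ (2 * k + 1) * h * g ^ (-(2 * k + 1))) := by
  rw [rcomm_eq_one_iff] at h₁ h₂
  set c : ℤ → H := fun m => g ^ m * h * g ^ (-m) with hc
  have conj (m n : ℤ) : g ^ m * c n * g ^ (-m) = c (m + n) := by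
    simp only [hc, neg_add_rev, zpow_add]; group
  have step (m : ℤ) : (c (m + 2))⁻¹ * c m = (c m)⁻¹ * c (m - 2) := by
    have e : (c 0)⁻¹ * c (-2) = (c (-2))⁻¹ * c (-4) := by
      have := h₂.eq
      simp only [hc, rcomm] at this ⊢
      have e1 : h⁻¹ * (g ^ 2)⁻¹ * h * g ^ 2 = (g ^ 2)⁻¹ * (h⁻¹ * (g ^ 2)⁻¹ * h * g ^ 2) * g ^ 2 := by
        rw [mul_assoc ((g ^ 2)⁻¹), this, inv_mul_cancel_left]
      convert e1 using 1 <;> group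
    have := congrArg (fun t => g ^ (m + 2) * t * g ^ (-(m + 2))) e
    have dist (x y : H) : g ^ (m + 2) * (x⁻¹ * y) * g ^ (-(m + 2)) =
        (g ^ (m + 2) * x * g ^ (-(m + 2)))⁻¹ * (g ^ (m + 2) * y * g ^ (-(m + 2))) := by
      rw [zpow_neg]; simp [mul_assoc]
    simp only [dist, conj] at this
    convert this using 3 <;> ring_nf
  have quot (k : ℤ) : (c (2 * k + 1))⁻¹ * c (2 * k - 1) = (c 1)⁻¹ * c (-1) := by
    induction k using Int.induction_on with
    | zero => norm_num
    | succ k ih =>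
      rw [← ih]
      convert step (2 * k + 1) using 3 <;> ring_nf
    | pred k ih =>
      rw [← ih]
      convert (step (2 * (-k - 1) + 1)).symm using 3 <;> ring_nf
  have pos : Commute h (c (-1)) := by
    have e : c (-1) = (h * (rcomm g h)⁻¹) := by simp only [hc, rcomm]; group
    rw [e]
    exact (Commute.refl h).mul_right h₁.symm.inv_right
  have neg : Commute h (c 1) := by
    have := (Commute.conj_iff g).2 pos
    simpa [hc, mul_assoc] using this.symm
  have hq : Commute h ((c 1)⁻¹ * c (-1)) := neg.inv_right.mul_right pos
  change Commute h (c (2 * k + 1))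
  induction k using Int.induction_on with
  | zero => simpa using neg
  | succ k ih =>
    have e : c (2 * (k + 1) + 1) = c (2 * k + 1) * ((c 1)⁻¹ * c (-1))⁻¹ := by
      rw [← quot (k + 1), show (2 * ((k : ℤ) + 1) - 1) = 2 * k + 1 by ring]
      group
    rw [e]
    exact ih.mul_right hq.inv_right
  | pred k ih =>
    have e : c (2 * (-k - 1) + 1) = c (2 * (-k) + 1) * ((c 1)⁻¹ * c (-1)) := by
      rw [← quot (-k), show (2 * (-(k : ℤ) - 1) + 1) = 2 * (-k) - 1 by ring]
      group
    rw [e]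
    exact ih.mul_right hq

end Commutation

/-- The group that the relators present. -/
abbrev Gam : Type := FreeGroup (Fin 2) ⧸ relSub

/-- The projection of the free group. -/
def toGam : FreeGroup (Fin 2) →* Gam := QuotientGroup.mk' relSub

theorem toGam_eq_one_iff {v : FreeGroup (Fin 2)} : toGam v = 1 ↔ v ∈ relSub :=
  QuotientGroup.eq_one_iff v

/-- The generator `a` of the presented group. -/
def al : Gam := toGam freeA

/-- The generator `b` of the presented group. -/
def be : Gam := toGam freeB

/-- The endomorphism `a ↦ b, b ↦ a²` of the presented group. -/
def sigmaGam : Gam →* Gam := QuotientGroup.map relSub relSub sigma fun _ => sigma_mem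

/-- The exponent sum of `b` on the presented group. -/
def expGam : Gam →* Multiplicative ℤ := QuotientGroup.lift relSub expB fun _ => hom_eq_one_of_mem _

/-- The recursion on the presented group. -/
def psiGam : Gam →* Wreath Gam :=
  QuotientGroup.lift relSub ((Wreath.map toGam).comp psi) fun v hv => by
    obtain ⟨h₁, h₂, h₃⟩ := psi_mem hv
    ext
    · exact toGam_eq_one_iff.2 h₁
    · exact toGam_eq_one_iff.2 h₂
    · exact h₃

theorem toGam_freeA : toGam freeA = al := rfl

theorem toGam_freeB : toGam freeB = be := rfl

theorem toGam_surjective : Function.Surjective toGam := QuotientGroup.mk'_surjective relSub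

theorem psiGam_toGam (v : FreeGroup (Fin 2)) : psiGam (toGam v) = Wreath.map toGam (psi v) := rfl

theorem psiGam_sigmaGam (g : Gam) :
    psiGam (sigmaGam g) = ⟨g, be ^ (expGam g).toAdd, false⟩ := by
  obtain ⟨v, rfl⟩ := toGam_surjective g
  change Wreath.map toGam (psi (sigma v)) = _
  rw [psi_sigma]
  simp only [Wreath.map, MonoidHom.coe_mk, OneHom.coe_mk, map_zpow]
  rfl

theorem sigmaGam_al : sigmaGam al = be := congrArg toGam sigma_freeA

theorem sigmaGam_be : sigmaGam be = al ^ 2 := congrArg toGam sigma_freeB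

/-- The subgroup generated by the conjugates of `a` by the powers of `b`. -/
def conjSub : Subgroup Gam := Subgroup.closure (Set.range fun i : ℤ => be ^ i * al * be ^ (-i))

theorem expGam_conjSub {g : Gam} (hg : g ∈ conjSub) : expGam g = 1 := by
  have h : conjSub ≤ expGam.ker := by
    rw [conjSub, Subgroup.closure_le]
    rintro _ ⟨i, rfl⟩
    have : expGam al = 1 := liftPair_freeA _ _
    simp [MonoidHom.mem_ker, this]
  exact h hg

theorem toGam_iterRel (n : ℕ) : toGam (iterRel n) = 1 :=
  toGam_eq_one_iff.2 (iterRel_mem n)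

theorem commute_be_conj (k : ℤ) : Commute be (al ^ (2 * k + 1) * be * al ^ (-(2 * k + 1))) := by
  apply commute_conj_zpow
  · simpa only [iterRel_zero, rel, map_rcomm, toGam_freeA, toGam_freeB] using toGam_iterRel 0
  · have := toGam_iterRel 1
    rw [iterRel_succ, iterRel_zero, rel] at this
    simpa only [map_rcomm, sigma_freeA, sigma_freeB, map_pow, toGam_freeA, toGam_freeB] using this

theorem sigmaGam_conj (i : ℤ) :
    sigmaGam (be ^ i * al * be ^ (-i)) = al ^ (2 * i) * be * al ^ (-(2 * i)) := by
  rw [map_mul, map_mul, map_zpow, map_zpow, sigmaGam_al, sigmaGam_be, ← zpow_natCast,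
    ← zpow_mul, ← zpow_mul]
  simp

/-- On generators these are conjugates of b by an even and by an odd power of a; after conjugation
their exponents differ by an odd number, so `commute_be_conj` applies. Under ψ the two factors live
on different subtrees. -/
theorem commute_sigmaGam {u v : Gam} (hu : u ∈ conjSub) (hv : v ∈ conjSub) :
    Commute (sigmaGam u) (al⁻¹ * sigmaGam v * al) := by
  unfold conjSub at hu hv
  induction hu using Subgroup.closure_induction with
  | one => simp
  | mul x y _ _ hx hy => rw [map_mul]; exact hx.mul_left hy
  | inv x _ hx => rw [map_inv]; exact hx.inv_left
  | mem x hx =>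
    obtain ⟨i, rfl⟩ := hx
    have conj_eq (x : Gam) : al⁻¹ * x * al = MulAut.conj al⁻¹ x := by simp
    simp only [conj_eq]
    induction hv using Subgroup.closure_induction with
    | one => simp
    | mul x y _ _ hx hy => rw [map_mul sigmaGam x, map_mul (MulAut.conj al⁻¹)]; exact hx.mul_right hy
    | inv x _ hx => rw [map_inv sigmaGam x, map_inv (MulAut.conj al⁻¹)]; exact hx.inv_right
    | mem x hx =>
      obtain ⟨j, rfl⟩ := hx
      rw [sigmaGam_conj, sigmaGam_conj]
      have h := (commute_be_conj (j - i - 1)).map (MulAut.conj (al ^ (2 * i)))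
      convert h using 1
      · rw [MulAut.conj_apply, zpow_neg]
      · simp only [MulAut.conj_apply]
        group

/-- The set of such products contains 1 and is stable under right multiplication by letters: a^m
b^(±1) a^(-m) is absorbed into u or v according to the parity of m. -/
theorem exists_normal_form (g : Gam) : ∃ u ∈ conjSub, ∃ v ∈ conjSub, ∃ m : ℤ,
    g = sigmaGam u * (al⁻¹ * sigmaGam v * al) * al ^ m := by
  have mem (i : ℤ) : be ^ i * al * be ^ (-i) ∈ conjSub := Subgroup.subset_closure ⟨i, rfl⟩
  have step (g : Gam) (w : Gam → Gam) (hw : ∀ x ∈ conjSub, w x ∈ conjSub)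
      (β : Gam) (hβ : ∀ i : ℤ, al ^ (2 * i) * β * al ^ (-(2 * i)) =
        sigmaGam (w (be ^ i * al * be ^ (-i))))
      (h : ∃ u ∈ conjSub, ∃ v ∈ conjSub, ∃ m : ℤ,
        g = sigmaGam u * (al⁻¹ * sigmaGam v * al) * al ^ m) :
      ∃ u ∈ conjSub, ∃ v ∈ conjSub, ∃ m : ℤ,
        g * β = sigmaGam u * (al⁻¹ * sigmaGam v * al) * al ^ m := by
    obtain ⟨u, hu, v, hv, m, rfl⟩ := h
    obtain ⟨i, rfl | rfl⟩ := m.even_or_odd'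
    · have hm := hw _ (mem i)
      refine ⟨_, mul_mem hu hm, v, hv, 2 * i, ?_⟩
      have hc := (commute_sigmaGam hm hv).eq
      rw [map_mul, mul_assoc (sigmaGam u) (sigmaGam _), hc, ← hβ]
      group
    -- The index is i + 1 because a^(2i+1) = a⁻¹ a^(2(i+1)): the conjugate is written in the form
    -- a⁻¹ σ(·) a.
    · have hm := hw _ (mem (i + 1))
      refine ⟨u, hu, _, mul_mem hv hm, 2 * i + 1, ?_⟩
      rw [map_mul, ← hβ]
      group
  obtain ⟨v, rfl⟩ := toGam_surjective g
  induction v using free_induction with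
  | one => exact ⟨1, one_mem _, 1, one_mem _, 0, by simp⟩
  | mul_a v h =>
    obtain ⟨u, hu, v', hv, m, h⟩ := h
    exact ⟨u, hu, v', hv, m + 1, by rw [map_mul, h, zpow_add_one, toGam_freeA, mul_assoc _ (al ^ m)]⟩
  | mul_a_inv v h =>
    obtain ⟨u, hu, v', hv, m, h⟩ := h
    exact ⟨u, hu, v', hv, m - 1, by
      rw [map_mul, map_inv, h, zpow_sub_one, toGam_freeA, mul_assoc _ (al ^ m)]⟩
  | mul_b v h =>
    rw [map_mul]
    exact step _ id (fun _ => id) _ (fun i => (sigmaGam_conj i).symm) h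
  | mul_b_inv v h =>
    rw [map_mul, map_inv]
    refine step _ (·⁻¹) (fun _ => inv_mem) _ (fun i => ?_) h
    rw [map_inv, sigmaGam_conj, toGam_freeB]
    group

theorem psiGam_al : psiGam al = ⟨be, 1, true⟩ := by
  rw [← toGam_freeA, psiGam_toGam, psi_freeA]
  simp [Wreath.map, toGam_freeB]

theorem psiGam_al_zpow (j : ℤ) : psiGam (al ^ (2 * j)) = ⟨be ^ j, be ^ j, false⟩ := by
  rw [zpow_mul, map_zpow, ← Wreath.mk_zpow]
  rw [show (2 : ℤ) = (2 : ℕ) from rfl, zpow_natCast, map_pow, psiGam_al]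
  simp [pow_two, Wreath.mul_def]

/-- Elements of `conjSub` have b-exponent 0, so for m = 2j the normal form maps to ⟨⟨u b^j, b⁻¹ v b
b^j⟩⟩. If this is 1, the b-exponent of the first coordinate gives j = 0, and then u = v = 1. Odd m
produces a swap. -/
theorem psiGam_injective : Function.Injective psiGam := by
  rw [injective_iff_map_eq_one]
  intro g hg
  obtain ⟨u, hu, v, hv, m, rfl⟩ := exists_normal_form g
  rw [map_mul, map_mul, psiGam_sigmaGam, map_mul, map_mul, psiGam_sigmaGam, map_inv, psiGam_al,
    expGam_conjSub hu, expGam_conjSub hv] at hg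
  obtain ⟨j, rfl | rfl⟩ := m.even_or_odd'
  · rw [psiGam_al_zpow] at hg
    simp only [Wreath.mul_def, Wreath.inv_def, Wreath.one_def, Wreath.mk.injEq] at hg
    simp at hg
    obtain ⟨h₁, h₂⟩ := hg
    have hj : j = 0 := by
      have hb : expGam be = Multiplicative.ofAdd (1 : ℤ) := liftPair_freeB _ _
      have := congrArg expGam h₁
      rw [map_mul, expGam_conjSub hu, map_zpow, hb, one_mul, map_one expGam, ← ofAdd_zsmul] at this
      simpa using this
    subst hj
    simp at h₁ h₂
    have h₃ : v = 1 := by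
      rwa [mul_assoc, inv_mul_eq_one, eq_comm, mul_eq_right] at h₂
    simp [h₁, h₃]
  · rw [zpow_add, map_mul, psiGam_al_zpow, zpow_one, psiGam_al] at hg
    simp [Wreath.mul_def, Wreath.inv_def, Wreath.one_def] at hg

theorem mem_relSub_of_psi_mem {v : FreeGroup (Fin 2)} (h : psi v ∈ Wreath.base relSub) :
    v ∈ relSub := by
  rw [← toGam_eq_one_iff]
  apply psiGam_injective
  obtain ⟨h₁, h₂, h₃⟩ := h
  rw [map_one]
  rw [psiGam_toGam]
  ext
  · exact toGam_eq_one_iff.2 h₁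
  · exact toGam_eq_one_iff.2 h₂
  · exact h₃

end Basilica

-- The action on the tree and the presentation.

namespace Basilica

/-- The action of words on the tree. -/
def toPerm : FreeGroup (Fin 2) →* RightPerm := liftPair a b

theorem act_toPerm_cons (v : FreeGroup (Fin 2)) (w : Vertex) :
    act (Letter.x :: w) (toPerm v) =
      cond (psi v).swap Letter.y Letter.x :: act w (toPerm (psi v).fst) ∧
    act (Letter.y :: w) (toPerm v) =
      cond (psi v).swap Letter.x Letter.y :: act w (toPerm (psi v).snd) := by
  have ha : toPerm freeA = a := liftPair_freeA _ _
  have hb : toPerm freeB = b := liftPair_freeB _ _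
  have hax (u : Vertex) : act (Letter.x :: u) a⁻¹ = Letter.y :: u := rfl
  have hay (u : Vertex) : act (Letter.y :: u) a⁻¹ = Letter.x :: act u b⁻¹ := rfl
  have hbx (u : Vertex) : act (Letter.x :: u) b⁻¹ = Letter.x :: act u a⁻¹ := rfl
  have hby (u : Vertex) : act (Letter.y :: u) b⁻¹ = Letter.y :: u := rfl
  induction v using free_induction with
  | one => exact ⟨rfl, rfl⟩
  | mul_a v h =>
    rw [map_mul, map_mul, act_mul, act_mul, h.1, h.2, ha, psi_freeA]
    generalize psi v = p
    obtain ⟨p, p', _ | _⟩ := p <;>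
      simp [Wreath.mul_def, act_a_x, act_a_y, hb, act_mul]
  | mul_a_inv v h =>
    rw [map_mul, map_mul, act_mul, act_mul, h.1, h.2, map_inv, map_inv, ha, psi_freeA]
    generalize psi v = p
    obtain ⟨p, p', _ | _⟩ := p <;>
      simp [Wreath.mul_def, Wreath.inv_def, hax, hay, hb, act_mul]
  | mul_b v h =>
    rw [map_mul, map_mul, act_mul, act_mul, h.1, h.2, hb, psi_freeB]
    generalize psi v = p
    obtain ⟨p, p', _ | _⟩ := p <;>
      simp [Wreath.mul_def, act_b_x, act_b_y, ha, act_mul]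
  | mul_b_inv v h =>
    rw [map_mul, map_mul, act_mul, act_mul, h.1, h.2, map_inv, map_inv, hb, psi_freeB]
    generalize psi v = p
    obtain ⟨p, p', _ | _⟩ := p <;>
      simp [Wreath.mul_def, Wreath.inv_def, hbx, hby, ha, act_mul]

theorem perm_ext {g h : RightPerm} (H : ∀ w, act w g = act w h) : g = h :=
  MulOpposite.unop_injective (Equiv.ext H)

theorem act_one (w : Vertex) : act w 1 = w := rfl

theorem act_toPerm_nil (v : FreeGroup (Fin 2)) : act [] (toPerm v) = [] := by
  have ha : toPerm freeA = a := liftPair_freeA _ _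
  have hb : toPerm freeB = b := liftPair_freeB _ _
  induction v using free_induction with
  | one => rfl
  | mul_a v h => rw [map_mul, act_mul, h, ha]; rfl
  | mul_a_inv v h => rw [map_mul, act_mul, h, map_inv, ha]; rfl
  | mul_b v h => rw [map_mul, act_mul, h, hb]; rfl
  | mul_b_inv v h => rw [map_mul, act_mul, h, map_inv, hb]; rfl

theorem toPerm_eq_one_iff (v : FreeGroup (Fin 2)) : toPerm v = 1 ↔
    toPerm (psi v).fst = 1 ∧ toPerm (psi v).snd = 1 ∧ (psi v).swap = false := by
  constructor
  · intro h
    have hs : (psi v).swap = false := by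
      have := (act_toPerm_cons v []).1
      rw [h, act_one] at this
      cases hs : (psi v).swap
      · rfl
      · simp [hs] at this
    refine ⟨perm_ext fun w => ?_, perm_ext fun w => ?_, hs⟩
    · have := (act_toPerm_cons v w).1
      rw [h, act_one] at this
      exact (List.cons.inj this).2.symm
    · have := (act_toPerm_cons v w).2
      rw [h, act_one] at this
      exact (List.cons.inj this).2.symm
  · rintro ⟨h₁, h₂, h₃⟩
    refine perm_ext fun w => ?_
    match w with
    | [] => exact act_toPerm_nil v
    | Letter.x :: w => rw [(act_toPerm_cons v w).1, h₁, h₃]; rfl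
    | Letter.y :: w => rw [(act_toPerm_cons v w).2, h₂, h₃]; rfl

theorem toPerm_iterRel (n : ℕ) : toPerm (iterRel n) = 1 := by
  induction n with
  | zero =>
    rw [toPerm_eq_one_iff, iterRel_zero, psi_rel]
    exact ⟨map_one _, map_one _, rfl⟩
  | succ n ih =>
    rw [toPerm_eq_one_iff, iterRel_succ, psi_sigma, hom_eq_one_of_mem _ (iterRel_mem n)]
    exact ⟨ih, map_one _, rfl⟩

/-- Infinite order of a, by descent: odd powers swap the subtrees, a^(2j) has sections b^j, and b^j
has first section a^j, with |j| < |2j| for j ≠ 0. -/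
theorem zpow_freeA_eq_zero (n : ℕ) : ∀ k : ℤ, k.natAbs ≤ n →
    toPerm (freeA ^ k) = 1 → k = 0 := by
  induction n using Nat.strong_induction_on with
  | _ n ih =>
  intro k hk h
  rw [toPerm_eq_one_iff] at h
  obtain ⟨j, rfl | rfl⟩ := k.even_or_odd'
  · by_contra hj
    have hpsi : psi (freeA ^ (2 * j)) = ⟨freeB ^ j, freeB ^ j, false⟩ := by
      rw [zpow_mul, show freeA ^ (2 : ℤ) = sigma freeB by rw [sigma_freeB]; rfl,
        map_zpow, psi_sigma, ← Wreath.mk_zpow]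
      simp [expB]
    rw [hpsi] at h
    have hb := (toPerm_eq_one_iff _).1 h.1
    rw [map_zpow, psi_freeB, Wreath.mk_zpow] at hb
    have := ih j.natAbs (by omega) j le_rfl hb.1
    omega
  · exfalso
    have hswap : (psi (freeA ^ (2 * j + 1))).swap = true := by
      rw [zpow_add, zpow_mul, show freeA ^ (2 : ℤ) = sigma freeB by rw [sigma_freeB]; rfl,
        map_mul, map_zpow, psi_sigma, Wreath.mk_zpow]
      simp [Wreath.mul_def]
    rw [hswap] at h
    exact Bool.noConfusion h.2.2

theorem zpow_freeB_eq_zero {k : ℤ} (h : toPerm (freeB ^ k) = 1) : k = 0 := by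
  rw [toPerm_eq_one_iff, map_zpow, psi_freeB, Wreath.mk_zpow] at h
  exact zpow_freeA_eq_zero _ k le_rfl h.1

/-- The sections of a word of length `n` have total length `n`; if one section is empty, then
the word is a power of `b`, up to factors that depend on its action on the first level. -/
theorem exists_sections (L : List (Fin 2 × Bool)) : ∃ L₀ L₁ : List (Fin 2 × Bool), ∃ s : Bool,
    psi (FreeGroup.mk L) = ⟨FreeGroup.mk L₀, FreeGroup.mk L₁, s⟩ ∧
    L₀.length + L₁.length = L.length ∧
    (L₁ = [] → ∃ k : ℤ, FreeGroup.mk L = freeB ^ k * cond s freeA 1) ∧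
    (L₀ = [] → ∃ k : ℤ, FreeGroup.mk L = freeA⁻¹ * freeB ^ k * cond s 1 freeA) := by
  induction L with
  | nil =>
    refine ⟨[], [], false, ?_, rfl, fun _ => ⟨0, ?_⟩, fun _ => ⟨0, ?_⟩⟩
    · rw [← FreeGroup.one_eq_mk, map_one]; rfl
    · simp [← FreeGroup.one_eq_mk]
    · simp [← FreeGroup.one_eq_mk]
  | cons l L ih =>
    obtain ⟨L₀, L₁, s, h, hlen, h₁, h₀⟩ := ih
    have cons (l : Fin 2 × Bool) (L) :
        FreeGroup.mk (l :: L) = FreeGroup.mk [l] * FreeGroup.mk L := by simp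
    have hB : FreeGroup.mk [((1 : Fin 2), true)] = freeB := rfl
    have hA : FreeGroup.mk [((0 : Fin 2), true)] = freeA := rfl
    have hB' : FreeGroup.mk [((1 : Fin 2), false)] = freeB⁻¹ := rfl
    have hA' : FreeGroup.mk [((0 : Fin 2), false)] = freeA⁻¹ := rfl
    rw [cons l L, map_mul, h]
    obtain ⟨i, e⟩ := l
    fin_cases i <;> cases e
    -- A leading a^(±1) exchanges the two sections, so each of the last two clauses is proved from
    -- the other.
    · refine ⟨L₁, (1, false) :: L₀, !s, ?_, ?_, ?_, ?_⟩
      · simp [hA', cons _ L₀, hB', Wreath.mul_def, Wreath.inv_def]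
      · simp; omega
      · simp
      · intro h
        obtain ⟨k, hk⟩ := h₁ h
        refine ⟨k, ?_⟩
        rw [hk, mul_assoc]
        cases s <;> rfl
    · refine ⟨(1, true) :: L₁, L₀, !s, ?_, ?_, ?_, ?_⟩
      · simp [hA, cons _ L₁, hB, Wreath.mul_def]
      · simp; omega
      · intro h
        obtain ⟨k, hk⟩ := h₀ h
        refine ⟨k, ?_⟩
        rw [hk]
        cases s <;> simp [hA, mul_assoc]
      · simp
    · refine ⟨(0, false) :: L₀, L₁, s, ?_, ?_, ?_, ?_⟩
      · simp [hB', cons _ L₀, hA', Wreath.mul_def, Wreath.inv_def]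
      · simp; omega
      · intro h
        obtain ⟨k, hk⟩ := h₁ h
        refine ⟨-1 + k, ?_⟩
        rw [hk, zpow_add, mul_assoc, zpow_neg_one]
        rfl
      · simp
    · refine ⟨(0, true) :: L₀, L₁, s, ?_, ?_, ?_, ?_⟩
      · simp [hB, cons _ L₀, hA, Wreath.mul_def]
      · simp; omega
      · intro h
        obtain ⟨k, hk⟩ := h₁ h
        refine ⟨1 + k, ?_⟩
        rw [hk, zpow_add, mul_assoc, zpow_one]
        rfl
      · simp

/-- If both section lists are nonempty, both are strictly shorter than `L`, and
`mem_relSub_of_psi_mem` lifts their membership. Otherwise the word is b^k or a⁻¹ b^k a, and k = 0.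
-/
theorem mk_mem_relSub (n : ℕ) : ∀ L : List (Fin 2 × Bool), L.length = n →
    toPerm (FreeGroup.mk L) = 1 → FreeGroup.mk L ∈ relSub := by
  induction n using Nat.strong_induction_on with
  | _ n ih =>
  intro L hL h
  obtain ⟨L₀, L₁, s, hpsi, hlen, h₁, h₀⟩ := exists_sections L
  have hsec := (toPerm_eq_one_iff _).1 h
  rw [hpsi] at hsec
  obtain ⟨e₀, e₁, rfl : s = false⟩ := hsec
  rcases eq_or_ne L₁ [] with hn | hn
  · obtain ⟨k, hk⟩ := h₁ hn
    rw [cond_false, mul_one] at hk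
    rw [hk] at h ⊢
    rw [zpow_freeB_eq_zero h, zpow_zero]
    exact one_mem _
  rcases eq_or_ne L₀ [] with hn' | hn'
  · obtain ⟨k, hk⟩ := h₀ hn'
    rw [cond_false] at hk
    rw [hk] at h ⊢
    have hb : toPerm (freeB ^ k) = 1 := by
      rwa [map_mul, map_mul, map_inv, mul_assoc, inv_mul_eq_one, eq_comm, mul_eq_right] at h
    rw [zpow_freeB_eq_zero hb]
    simp [one_mem]
  · have l₀ := List.length_pos_iff.2 hn'
    have l₁ := List.length_pos_iff.2 hn
    apply mem_relSub_of_psi_mem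
    rw [hpsi]
    exact ⟨ih _ (by omega) L₀ rfl e₀, ih _ (by omega) L₁ rfl e₁, rfl⟩

theorem ker_toPerm : toPerm.ker = relSub := by
  refine le_antisymm (fun v hv => ?_) (relSub_le toPerm_iterRel)
  obtain ⟨L, rfl⟩ := Quot.exists_rep v
  exact mk_mem_relSub _ L rfl hv

/-- The projection from the free group to `G`. -/
def toG : FreeGroup (Fin 2) →* G := liftPair genA genB

theorem coe_toG (v : FreeGroup (Fin 2)) : (toG v : RightPerm) = toPerm v := by
  have : G.subtype.comp toG = toPerm := by
    apply hom_ext <;> simp [toG, toPerm, genA, genB]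
  exact DFunLike.congr_fun this v

theorem ker_toG : toG.ker = relSub := by
  ext v
  rw [← ker_toPerm, MonoidHom.mem_ker, MonoidHom.mem_ker, ← coe_toG, OneMemClass.coe_eq_one]

theorem toG_surjective : Function.Surjective toG := by
  rintro ⟨g, hg⟩
  have h : G ≤ toPerm.range := by
    rw [G, Subgroup.closure_le]
    rintro _ (rfl | rfl)
    · exact ⟨freeA, liftPair_freeA _ _⟩
    · exact ⟨freeB, liftPair_freeB _ _⟩
  obtain ⟨v, hv⟩ := h hg
  exact ⟨v, Subtype.ext ((coe_toG v).trans hv)⟩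

/-- The presentation of `G`. -/
noncomputable def presentationEquiv : PresentedGroup relators ≃* G :=
  (QuotientGroup.quotientMulEquivOfEq ker_toG.symm).trans
    (QuotientGroup.quotientKerEquivOfSurjective toG toG_surjective)

end Basilica

-- Hopf's formula by means of inhomogeneous chains.

section Hopf

/-- A `2`-cocycle of `H` with values in the trivial module `D`. -/
structure TrivialCocycle (H D : Type*) [Group H] [AddCommGroup D] where
  /-- the values of the cocycle -/
  toFun : H → H → D
  /-- the cocycle condition -/
  cocycle : ∀ g h k, toFun g h + toFun (g * h) k = toFun h k + toFun g (h * k)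

namespace TrivialCocycle

variable {H D : Type*} [Group H] [AddCommGroup D] (c : TrivialCocycle H D)

theorem one_left (g : H) : c.toFun 1 g = c.toFun 1 1 := by
  have := c.cocycle 1 1 g
  simp only [one_mul] at this
  exact (add_right_cancel this).symm

theorem one_right (g : H) : c.toFun g 1 = c.toFun 1 1 := by
  have := c.cocycle g 1 1
  simp only [mul_one] at this
  exact add_right_cancel this

/-- The central extension of `H` by `D` that belongs to a cocycle. -/
@[ext]
structure Extension (c : TrivialCocycle H D) where
  /-- the component in `D` -/
  fst : D
  /-- the component in `H` -/
  snd : H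

instance : Mul c.Extension := ⟨fun p q => ⟨p.fst + q.fst + c.toFun p.snd q.snd, p.snd * q.snd⟩⟩

instance : One c.Extension := ⟨⟨-c.toFun 1 1, 1⟩⟩

instance : Inv c.Extension :=
  ⟨fun p => ⟨-p.fst - c.toFun 1 1 - c.toFun p.snd⁻¹ p.snd, p.snd⁻¹⟩⟩

theorem Extension.mul_def (p q : c.Extension) :
    p * q = ⟨p.fst + q.fst + c.toFun p.snd q.snd, p.snd * q.snd⟩ := rfl

theorem Extension.one_def : (1 : c.Extension) = ⟨-c.toFun 1 1, 1⟩ := rfl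

theorem Extension.inv_def (p : c.Extension) :
    p⁻¹ = ⟨-p.fst - c.toFun 1 1 - c.toFun p.snd⁻¹ p.snd, p.snd⁻¹⟩ := rfl

instance : Group c.Extension :=
  Group.ofLeftAxioms
    (by
      intro p q r
      ext
      · have := c.cocycle p.snd q.snd r.snd
        simp only [Extension.mul_def]
        calc _ = p.fst + q.fst + r.fst +
              (c.toFun p.snd q.snd + c.toFun (p.snd * q.snd) r.snd) := by abel
          _ = _ := by rw [this]; abel
      · exact mul_assoc _ _ _)
    (by
      intro p
      ext
      · simp [Extension.mul_def, Extension.one_def, c.one_left]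
      · exact one_mul _)
    (by
      intro p
      ext
      · simp only [Extension.mul_def, Extension.one_def, Extension.inv_def]
        abel
      · exact inv_mul_cancel _)

/-- The projection of the central extension. -/
def Extension.proj : c.Extension →* H where
  toFun := Extension.snd
  map_one' := rfl
  map_mul' _ _ := rfl

/-- A cocycle becomes a coboundary on a free group. -/
theorem exists_trivialization {S : Type*} (π : FreeGroup S →* H) : ∃ d : FreeGroup S → D,
    ∀ v w, d (v * w) = d v + d w + c.toFun (π v) (π w) := by
  -- By freeness π lifts to the central extension; the central component of the lift is the required
  -- d.
  let L : FreeGroup S →* c.Extension := FreeGroup.lift fun i => ⟨0, π (FreeGroup.of i)⟩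
  have hL : (Extension.proj c).comp L = π := by
    ext i
    simp [L, Extension.proj]
  have hs (v) : (L v).snd = π v := DFunLike.congr_fun hL v
  refine ⟨fun v => (L v).fst, fun v w => ?_⟩
  simp only [map_mul, Extension.mul_def, hs]

end TrivialCocycle

/-- `f` restricts to a homomorphism from the kernel of `π` to `ℤ` that is invariant under
conjugation. -/
structure IsInvariantChar {F H : Type*} [Group F] [Group H] (π : F →* H) (f : F → ℤ) : Prop where
  map_mul : ∀ k l, π k = 1 → π l = 1 → f (k * l) = f k + f l
  conj : ∀ v k, π k = 1 → f (v * k * v⁻¹) = f k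

open Finsupp groupHomology

variable {S H : Type} [Group H] (π : FreeGroup S →* H)

variable (H) in
/-- The inhomogeneous `2`-chains of `H` modulo boundaries. -/
abbrev ChainsModBoundaries : Type :=
  (H × H →₀ (Rep.trivial ℤ H ℤ)) ⧸ boundaries₂ (Rep.trivial ℤ H ℤ)

variable (H) in
/-- The tautological cocycle with values in the chains modulo boundaries. -/
noncomputable def universalCocycle : TrivialCocycle H (ChainsModBoundaries H) where
  toFun g h := Submodule.Quotient.mk (single (g, h) (1 : ℤ))
  cocycle g h k := by
    rw [← Submodule.Quotient.mk_add, ← Submodule.Quotient.mk_add, eq_comm, Submodule.Quotient.eq]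
    refine ⟨single (g, h, k) (1 : ℤ), ?_⟩
    refine (d₃₂_single (A := Rep.trivial ℤ H ℤ) (g, h, k) (1 : ℤ)).trans ?_
    simp only [Representation.isTrivial_def, LinearMap.id_coe, id_eq]
    abel

theorem mk_single (p : H × H) (m : ℤ) :
    (Submodule.Quotient.mk (single p m) : ChainsModBoundaries H) =
      m • (universalCocycle H).toFun p.1 p.2 := by
  change _ = m • Submodule.Quotient.mk (single p (1 : ℤ))
  rw [← Submodule.Quotient.mk_smul, smul_single]
  congr 2
  exact (mul_one m).symm

/-- `d` trivializes the pull-back of the tautological cocycle to a free group. -/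
def Trivializes (π : FreeGroup S →* H) (d : FreeGroup S → ChainsModBoundaries H) : Prop :=
  ∀ v w, d (v * w) = d v + d w + (universalCocycle H).toFun (π v) (π w)

/-- The map from the kernel of `π` to the chains modulo boundaries of `H`. -/
noncomputable def hopfMap (d : FreeGroup S → ChainsModBoundaries H) (k : FreeGroup S) :
    ChainsModBoundaries H := d k + (universalCocycle H).toFun 1 1

section

variable {π} {d : FreeGroup S → ChainsModBoundaries H} {k l : FreeGroup S}

/-- The tautological cocycle is not normalised; the summand c(1, 1) in `hopfMap` corrects for this.
-/
theorem hopfMap_mul (hd : Trivializes π d) (hk : π k = 1) (hl : π l = 1) :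
    hopfMap d (k * l) = hopfMap d k + hopfMap d l := by
  rw [hopfMap, hd, hk, hl, hopfMap, hopfMap]
  abel

theorem apply_mul_of_ker (hd : Trivializes π d) (hk : π k = 1) (v : FreeGroup S) :
    d (k * v) = hopfMap d k + d v := by
  rw [hd, hk, (universalCocycle H).one_left, hopfMap]
  abel

theorem hopfMap_one (hd : Trivializes π d) : hopfMap d 1 = 0 := by
  have := hopfMap_mul hd (map_one π) (map_one π)
  rwa [mul_one, right_eq_add] at this

theorem hopfMap_inv (hd : Trivializes π d) (hk : π k = 1) : hopfMap d k⁻¹ = -hopfMap d k := by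
  have := hopfMap_mul hd (k := k⁻¹) (by rw [map_inv, hk, inv_one]) hk
  rw [inv_mul_cancel, hopfMap_one hd] at this
  exact eq_neg_of_add_eq_zero_left this.symm

theorem hopfMap_conj (hd : Trivializes π d) (hk : π k = 1) (v : FreeGroup S) :
    hopfMap d (v * k * v⁻¹) = hopfMap d k := by
  have h := apply_mul_of_ker hd (k := v * k * v⁻¹) (by simp [hk]) v
  rw [inv_mul_cancel_right, hd, hk, (universalCocycle H).one_right] at h
  rw [hopfMap, ← add_right_cancel_iff (a := d v), ← hopfMap, ← h, hopfMap]
  abel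

theorem hopfMap_mem_span (hd : Trivializes π d) {ι : Type*} {r : ι → FreeGroup S}
    (hr : π.ker = Subgroup.normalClosure (Set.range r)) (hk : π k = 1) :
    hopfMap d k ∈ Submodule.span ℤ (Set.range fun i => hopfMap d (r i)) := by
  let N : Subgroup (FreeGroup S) :=
    { carrier := {k | π k = 1 ∧
        hopfMap d k ∈ Submodule.span ℤ (Set.range fun i => hopfMap d (r i))}
      one_mem' := ⟨map_one π, by rw [hopfMap_one hd]; exact zero_mem _⟩
      mul_mem' := by
        rintro k l ⟨hk, hk'⟩ ⟨hl, hl'⟩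
        exact ⟨by rw [map_mul, hk, hl, one_mul],
          by rw [hopfMap_mul hd hk hl]; exact add_mem hk' hl'⟩
      inv_mem' := by
        rintro k ⟨hk, hk'⟩
        exact ⟨by rw [map_inv, hk, inv_one], by rw [hopfMap_inv hd hk]; exact neg_mem hk'⟩ }
  have hN : N.Normal := by
    constructor
    rintro k ⟨hk, hk'⟩ v
    exact ⟨by simp [hk], by rw [hopfMap_conj hd hk]; exact hk'⟩
  have h : π.ker ≤ N := by
    rw [hr]
    refine Subgroup.normalClosure_le_normal ?_
    rintro _ ⟨i, rfl⟩
    have : r i ∈ π.ker := hr ▸ Subgroup.subset_normalClosure ⟨i, rfl⟩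
    exact ⟨this, Submodule.subset_span ⟨i, rfl⟩⟩
  exact (h hk).2

theorem d₂₁_single_trivial (p : H × H) (m : ℤ) :
    (d₂₁ (Rep.trivial ℤ H ℤ)).hom (single p m) =
      (single p.2 m - single (p.1 * p.2) m + single p.1 m : H →₀ ℤ) :=
  d₂₁_single (A := Rep.trivial ℤ H ℤ) p m

theorem mk_mem_span_of_mem_cycles₂ (hd : Trivializes π d) (hπ : Function.Surjective π)
    {ι : Type*} {r : ι → FreeGroup S}
    (hr : π.ker = Subgroup.normalClosure (Set.range r)) {z : H × H →₀ (Rep.trivial ℤ H ℤ)}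
    (hz : z ∈ cycles₂ (Rep.trivial ℤ H ℤ)) :
    (Submodule.Quotient.mk z : ChainsModBoundaries H) ∈
      Submodule.span ℤ (Set.range fun i => hopfMap d (r i)) := by
  obtain ⟨w, hw⟩ := hπ.hasRightInverse
  let E : (H →₀ ℤ) →ₗ[ℤ] ChainsModBoundaries H := Finsupp.linearCombination ℤ fun g => d (w g)
  -- For a single pair (g, h) the left side is `hopfMap` at the relation w(g) w(h) w(gh)⁻¹. On
  -- cycles the correction term `E` vanishes.
  have key (x : H × H →₀ ℤ) : (Submodule.Quotient.mk x : ChainsModBoundaries H) +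
      E ((d₂₁ (Rep.trivial ℤ H ℤ)).hom x) ∈
      Submodule.span ℤ (Set.range fun i => hopfMap d (r i)) := by
    induction x using Finsupp.induction_linear with
    | zero =>
      have h₀ : (Submodule.Quotient.mk (0 : H × H →₀ ℤ) : ChainsModBoundaries H) = 0 :=
        Submodule.Quotient.mk_zero _
      have h₁ : (d₂₁ (Rep.trivial ℤ H ℤ)).hom (0 : H × H →₀ ℤ) = 0 := map_zero _
      rw [h₀, h₁, map_zero, add_zero]
      exact zero_mem _
    | add x y hx hy =>
      have h₀ : (Submodule.Quotient.mk (x + y) : ChainsModBoundaries H) =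
        Submodule.Quotient.mk x + Submodule.Quotient.mk y := Submodule.Quotient.mk_add _
      have h₁ : (d₂₁ (Rep.trivial ℤ H ℤ)).hom (x + y) =
        (d₂₁ (Rep.trivial ℤ H ℤ)).hom x + (d₂₁ (Rep.trivial ℤ H ℤ)).hom y := map_add _ _ _
      rw [h₀, h₁, map_add, add_add_add_comm]
      exact add_mem hx hy
    | single p m =>
      obtain ⟨g, h⟩ := p
      have hk : π (w g * w h * (w (g * h))⁻¹) = 1 := by simp [hw _]
      have e := apply_mul_of_ker hd hk (w (g * h))
      rw [inv_mul_cancel_right, hd, hw, hw] at e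
      rw [d₂₁_single_trivial, mk_single, map_add, map_sub]
      simp only [E, Finsupp.linearCombination_single]
      rw [← smul_sub, ← smul_add, ← smul_add]
      refine Submodule.smul_mem _ _ ?_
      convert hopfMap_mem_span hd hr hk using 1
      rw [eq_sub_of_add_eq e.symm]
      abel
  have h := key z
  rwa [show (d₂₁ (Rep.trivial ℤ H ℤ)).hom z = 0 from hz, map_zero, add_zero] at h

theorem map_eq_one_of_mem_commutator {F A : Type*} [Group F] [CommGroup A] (f : F →* A) {v : F}
    (hv : v ∈ commutator F) : f v = 1 :=
  Abelianization.commutator_subset_ker f hv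

theorem exists_cycle (hd : Trivializes π d) (hab : π.ker ≤ commutator (FreeGroup S))
    (hk : π k = 1) : ∃ z : cycles₂ (Rep.trivial ℤ H ℤ), Submodule.Quotient.mk z.1 = hopfMap d k := by
  let bd : ChainsModBoundaries H →ₗ[ℤ] (H →₀ ℤ) :=
    (boundaries₂ (Rep.trivial ℤ H ℤ)).liftQ (d₂₁ (Rep.trivial ℤ H ℤ)).hom
      (boundaries₂_le_cycles₂ _)
  have hbd (g h : H) : bd ((universalCocycle H).toFun g h) =
      single h 1 - single (g * h) 1 + single g 1 := d₂₁_single_trivial (g, h) 1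
  -- The boundary of d fails to be additive exactly by the coboundary of v ↦ [π v]; the sum is a
  -- homomorphism to an abelian group, hence trivial on the kernel of π.
  let χ : FreeGroup S →* Multiplicative (H →₀ ℤ) := MonoidHom.mk'
    (fun v => Multiplicative.ofAdd (bd (d v) + single (π v) 1)) fun v w => by
      rw [← ofAdd_add]
      congr 1
      rw [hd, map_mul, map_add bd, map_add bd, hbd]
      abel
  have hχ : bd (d k) + single (π k) 1 = 0 := map_eq_one_of_mem_commutator χ (hab hk)
  obtain ⟨z, hz⟩ := Submodule.Quotient.mk_surjective _ (hopfMap d k)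
  refine ⟨⟨z, ?_⟩, hz⟩
  change bd (Submodule.Quotient.mk z) = 0
  rw [hz, hopfMap, map_add, hbd, ← hχ, hk, mul_one]
  abel

/-- An invariant character f pushes the extension by ker π out to a central extension by ℤ. Its
cocycle, for a set-theoretic section w, is a functional ℓ on chains modulo boundaries, and f agrees
with ℓ ∘ `hopfMap` up to a homomorphism on the free group, which dies on the kernel. -/
theorem exists_linearMap (hd : Trivializes π d) (hπ : Function.Surjective π)
    (hab : π.ker ≤ commutator (FreeGroup S)) {f : FreeGroup S → ℤ} (hf : IsInvariantChar π f) :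
    ∃ ℓ : ChainsModBoundaries H →ₗ[ℤ] ℤ, ∀ k, π k = 1 → ℓ (hopfMap d k) = f k := by
  obtain ⟨w, hw⟩ := hπ.hasRightInverse
  let c : H → H → ℤ := fun g h => f (w g * w h * (w (g * h))⁻¹)
  have key (v v' : FreeGroup S) : f (v * v' * (w (π (v * v')))⁻¹) =
      f (v * (w (π v))⁻¹) + f (v' * (w (π v'))⁻¹) + c (π v) (π v') := by
    rw [← hf.conj (w (π v)) (v' * (w (π v'))⁻¹) (by simp [hw _]),
      ← hf.map_mul _ _ (by simp [hw _]) (by simp [hw _]),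
      ← hf.map_mul _ _ (by simp [hw _]) (by simp [hw _])]
    congr 1
    simp [mul_assoc]
  have hc (g h k : H) : c g h + c (g * h) k = c h k + c g (h * k) := by
    have h₁ := key (w g * w h) (w k)
    have h₂ := key (w g) (w h * w k)
    simp only [map_mul, hw _, mul_inv_cancel] at h₁ h₂
    have h₀ : f 1 = 0 := by
      have := hf.map_mul 1 1 (map_one _) (map_one _)
      simpa using this
    rw [mul_assoc g, mul_assoc (w g), h₂, h₀] at h₁
    simp only [c] at h₁ ⊢
    linarith
  let ℓ₀ : (H × H →₀ ℤ) →ₗ[ℤ] ℤ := Finsupp.linearCombination ℤ fun p => c p.1 p.2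
  have hℓ₀ : boundaries₂ (Rep.trivial ℤ H ℤ) ≤ LinearMap.ker ℓ₀ := by
    rintro _ ⟨x, rfl⟩
    have : ℓ₀ ∘ₗ (d₃₂ (Rep.trivial ℤ H ℤ)).hom = 0 := by
      refine Finsupp.lhom_ext fun p m => ?_
      refine (congrArg ℓ₀ (d₃₂_single (A := Rep.trivial ℤ H ℤ) p m)).trans ?_
      obtain ⟨g, h, k⟩ := p
      simp only [Representation.isTrivial_def, LinearMap.id_coe, id_eq]
      refine (map_sub ℓ₀ _ _).trans ?_
      change ℓ₀ _ - ℓ₀ _ = (0 : ℤ)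
      rw [map_add, map_sub]
      simp only [ℓ₀, Finsupp.linearCombination_single, smul_eq_mul]
      linear_combination (-m) * hc g h k
    exact LinearMap.congr_fun this x
  let ℓ : ChainsModBoundaries H →ₗ[ℤ] ℤ := (boundaries₂ (Rep.trivial ℤ H ℤ)).liftQ ℓ₀ hℓ₀
  have hℓ (g h : H) : ℓ ((universalCocycle H).toFun g h) = c g h := by
    refine (Finsupp.linearCombination_single ℤ 1 (g, h)).trans (one_smul _ _)
  let δ : FreeGroup S →* Multiplicative ℤ := MonoidHom.mk'
    (fun v => Multiplicative.ofAdd (f (v * (w (π v))⁻¹) - ℓ (d v))) fun v v' => by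
      rw [← ofAdd_add, key, hd, map_add, map_add, hℓ]
      congr 1
      ring
  refine ⟨ℓ, fun k hk => ?_⟩
  have hδ : f (k * (w (π k))⁻¹) - ℓ (d k) = 0 := map_eq_one_of_mem_commutator δ (hab hk)
  -- The section need not satisfy w 1 = 1; the resulting term f(w 1) cancels against ℓ(c(1, 1)).
  have h₁ : π (w 1) = 1 := hw 1
  have h₂ : f ((w 1)⁻¹ * w 1) = f (w 1)⁻¹ + f (w 1) := hf.map_mul _ _ (by simp [h₁]) h₁
  have h₃ : f 1 = 0 := by
    have := hf.map_mul 1 1 (map_one _) (map_one _)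
    simpa using this
  rw [hk, hf.map_mul _ _ hk (by simp [h₁])] at hδ
  rw [inv_mul_cancel, h₃] at h₂
  rw [hopfMap, map_add, hℓ]
  simp only [c, mul_one, mul_inv_cancel_right]
  linarith

/-- If the kernel of `π` lies in the commutator subgroup and is generated, as a normal subgroup,
by elements that the invariant characters separate, then these elements give a basis of the second
homology group. -/
theorem nonempty_basis_H2 (π : FreeGroup S →* H) (hπ : Function.Surjective π)
    (hab : π.ker ≤ commutator (FreeGroup S)) {ι : Type*} {r : ι → FreeGroup S}
    (hr : π.ker = Subgroup.normalClosure (Set.range r))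
    (hindep : ∀ c : ι →₀ ℤ,
      (∀ f, IsInvariantChar π f → (c.sum fun i m => m * f (r i)) = 0) → c = 0) :
    Nonempty (Module.Basis ι ℤ (groupHomology (Rep.trivial ℤ H ℤ) 2)) := by
  obtain ⟨d, hd⟩ := (universalCocycle H).exists_trivialization π
  replace hd : Trivializes π d := hd
  have hri (i : ι) : π (r i) = 1 := by
    have : r i ∈ π.ker := hr ▸ Subgroup.subset_normalClosure ⟨i, rfl⟩
    exact this
  choose z hz using fun i => exists_cycle hd hab (hri i)
  let P : cycles₂ (Rep.trivial ℤ H ℤ) →ₗ[ℤ] groupHomology (Rep.trivial ℤ H ℤ) 2 :=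
    (H2π (Rep.trivial ℤ H ℤ)).hom
  have hP (x) : P x = 0 ↔ (Submodule.Quotient.mk x.1 : ChainsModBoundaries H) = 0 :=
    (H2π_eq_zero_iff x).trans (Submodule.Quotient.mk_eq_zero _).symm
  let q : cycles₂ (Rep.trivial ℤ H ℤ) →ₗ[ℤ] ChainsModBoundaries H :=
    (boundaries₂ (Rep.trivial ℤ H ℤ)).mkQ ∘ₗ (cycles₂ (Rep.trivial ℤ H ℤ)).subtype
  have hq (c : ι →₀ ℤ) : q (Finsupp.linearCombination ℤ z c) =
      Finsupp.linearCombination ℤ (fun i => hopfMap d (r i)) c := by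
    rw [Finsupp.apply_linearCombination]
    congr 2
    exact funext hz
  refine ⟨Module.Basis.mk (v := fun i => P (z i)) ?_ ?_⟩
  · rw [linearIndependent_iff]
    intro c hc
    apply hindep
    intro f hf
    obtain ⟨ℓ, hℓ⟩ := exists_linearMap hd hπ hab hf
    rw [show (fun i => P (z i)) = P ∘ z from rfl, ← Finsupp.apply_linearCombination, hP] at hc
    have := congrArg ℓ ((hq c).symm.trans hc)
    rw [map_zero, Finsupp.apply_linearCombination, Finsupp.linearCombination_apply] at this
    simpa [hℓ _ (hri _)] using this
  · intro x _
    obtain ⟨y, rfl⟩ : ∃ y, P y = x :=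
      H2_induction_on (C := fun x => ∃ y, P y = x) x fun y => ⟨y, rfl⟩
    have hy := mk_mem_span_of_mem_cycles₂ hd hπ hr y.2
    rw [Finsupp.mem_span_range_iff_exists_finsupp] at hy
    rw [Finsupp.mem_span_range_iff_exists_finsupp]
    obtain ⟨c, hc⟩ := hy
    refine ⟨c, ?_⟩
    rw [← Finsupp.linearCombination_apply] at hc ⊢
    rw [← hq] at hc
    rw [show (fun i => P (z i)) = P ∘ z from rfl, ← Finsupp.apply_linearCombination,
      ← sub_eq_zero, ← map_sub, hP]
    change q (_ - _) = 0
    rw [map_sub, hc]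
    exact sub_self _

end

end Hopf

-- Invariant characters and independence of the relators.

namespace Basilica

/-- A nilpotent group: the semidirect product of `ℤ³` by `ℤ`, where `n` acts as
`(x, y, z) ↦ (x, y + n x, z + 2 n y + n² x)`. -/
@[ext]
structure Nil where
  /-- the first coordinate in `ℤ³` -/
  x : ℤ
  /-- the second coordinate in `ℤ³` -/
  y : ℤ
  /-- the third coordinate in `ℤ³` -/
  z : ℤ
  /-- the coordinate in the quotient `ℤ` -/
  n : ℤ

namespace Nil

instance : Mul Nil :=
  ⟨fun p q => ⟨p.x + q.x, p.y + q.n * p.x + q.y, p.z + 2 * q.n * p.y + q.n ^ 2 * p.x + q.z,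
    p.n + q.n⟩⟩

instance : One Nil := ⟨⟨0, 0, 0, 0⟩⟩

instance : Inv Nil :=
  ⟨fun p => ⟨-p.x, -p.y + p.n * p.x, -p.z + 2 * p.n * p.y - p.n ^ 2 * p.x, -p.n⟩⟩

theorem mul_def (p q : Nil) : p * q =
    ⟨p.x + q.x, p.y + q.n * p.x + q.y, p.z + 2 * q.n * p.y + q.n ^ 2 * p.x + q.z,
      p.n + q.n⟩ := rfl

theorem one_def : (1 : Nil) = ⟨0, 0, 0, 0⟩ := rfl

theorem inv_def (p : Nil) :
    p⁻¹ = ⟨-p.x, -p.y + p.n * p.x, -p.z + 2 * p.n * p.y - p.n ^ 2 * p.x, -p.n⟩ := rfl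

instance : Group Nil :=
  Group.ofLeftAxioms
    (by intro p q r; ext <;> simp only [mul_def] <;> ring)
    (by intro p; ext <;> simp [mul_def, one_def])
    (by intro p; ext <;> simp only [mul_def, one_def, inv_def] <;> ring)

/-- The central subgroup of the elements `(0, 0, z)`. -/
def centre : Subgroup Nil where
  carrier := {p | p.x = 0 ∧ p.y = 0 ∧ p.n = 0}
  one_mem' := ⟨rfl, rfl, rfl⟩
  mul_mem' := by
    rintro p q ⟨h₁, h₂, h₃⟩ ⟨h₄, h₅, h₆⟩
    simp [mul_def, h₁, h₂, h₃, h₄, h₅, h₆]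
  inv_mem' := by
    rintro p ⟨h₁, h₂, h₃⟩
    simp [inv_def, h₁, h₂, h₃]

theorem conj_of_mem_centre {p : Nil} (hp : p ∈ centre) (q : Nil) : q * p * q⁻¹ = p := by
  obtain ⟨h₁, h₂, h₃⟩ := hp
  ext <;> simp only [mul_def, inv_def, h₁, h₂, h₃] <;> ring

instance : centre.Normal := ⟨fun p hp q => by rwa [conj_of_mem_centre hp]⟩

/-- The action of ℤ on ℤ³ is unipotent, and each commutator moves one step down the coordinate flag.
-/
theorem rcomm_rcomm_mem_centre (p q : Nil) : rcomm (rcomm p q) q ∈ centre := by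
  refine ⟨?_, ?_, ?_⟩ <;> simp only [rcomm, mul_def, inv_def] <;> ring

end Nil

/-- The homomorphism to the nilpotent group. -/
def toNil : FreeGroup (Fin 2) →* Nil := liftPair ⟨1, 0, 0, 0⟩ ⟨0, 0, 0, 1⟩

theorem toNil_mem {v : FreeGroup (Fin 2)} (hv : v ∈ relSub) : toNil v ∈ Nil.centre := by
  refine relSub_le (N := Nil.centre.comap toNil) (fun n => ?_) hv
  simpa only [Subgroup.mem_comap, iterRel, rel, map_rcomm] using Nil.rcomm_rcomm_mem_centre _ _

theorem toG_eq_one_iff {v : FreeGroup (Fin 2)} : toG v = 1 ↔ v ∈ relSub := by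
  rw [← ker_toG, MonoidHom.mem_ker]

theorem isInvariantChar_toNil : IsInvariantChar toG fun v => (toNil v).z where
  map_mul k l hk hl := by
    obtain ⟨h₁, h₂, -⟩ := toNil_mem (toG_eq_one_iff.1 hk)
    simp [Nil.mul_def, h₁, h₂]
  conj v k hk := by
    simp only [map_mul, map_inv]
    rw [Nil.conj_of_mem_centre (toNil_mem (toG_eq_one_iff.1 hk))]

/-- [a, b] maps to (0, 1, 1) in ℤ³, and the commutator of this with b is (0, 0, 2). -/
theorem toNil_rel : (toNil rel).z ≠ 0 := by
  simp only [rel, map_rcomm, toNil, liftPair_freeA, liftPair_freeB]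
  simp [rcomm, Nil.mul_def, Nil.inv_def]

/-- The operator on invariant characters that is dual to the decomposition of a relation into its
sections. -/
def transfer (f : FreeGroup (Fin 2) → ℤ) (v : FreeGroup (Fin 2)) : ℤ :=
  f (psi v).fst + f (psi v).snd

/-- Conjugation conjugates the two sections of a relation and possibly exchanges them; their sum is
insensitive to both. -/
theorem isInvariantChar_transfer {f : FreeGroup (Fin 2) → ℤ} (hf : IsInvariantChar toG f) :
    IsInvariantChar toG (transfer f) where
  map_mul k l hk hl := by
    obtain ⟨h₁, h₂, h₃⟩ := psi_mem (toG_eq_one_iff.1 hk)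
    obtain ⟨h₄, h₅, h₆⟩ := psi_mem (toG_eq_one_iff.1 hl)
    rw [← toG_eq_one_iff] at h₁ h₂ h₄ h₅
    simp only [transfer, map_mul, Wreath.mul_def, h₃, cond_false]
    rw [hf.map_mul _ _ h₁ h₄, hf.map_mul _ _ h₂ h₅]
    ring
  conj v k hk := by
    obtain ⟨h₁, h₂, h₃⟩ := psi_mem (toG_eq_one_iff.1 hk)
    rw [← toG_eq_one_iff] at h₁ h₂
    simp only [transfer, map_mul, map_inv]
    generalize psi v = p
    obtain ⟨p, p', _ | _⟩ := p <;>
      simp [Wreath.mul_def, Wreath.inv_def, h₃, hf.conj _ _ h₁, hf.conj _ _ h₂, add_comm]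

theorem IsInvariantChar.map_one {F H : Type*} [Group F] [Group H] {π : F →* H} {f : F → ℤ}
    (hf : IsInvariantChar π f) : f 1 = 0 := by
  simpa using hf.map_mul 1 1 (_root_.map_one π) (_root_.map_one π)

theorem transfer_iterRel_zero {f : FreeGroup (Fin 2) → ℤ} (hf : IsInvariantChar toG f) :
    transfer f (iterRel 0) = 0 := by
  rw [transfer, iterRel_zero, psi_rel, Wreath.one_def, IsInvariantChar.map_one hf, add_zero]

theorem transfer_iterRel_succ {f : FreeGroup (Fin 2) → ℤ} (hf : IsInvariantChar toG f) (n : ℕ) :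
    transfer f (iterRel (n + 1)) = f (iterRel n) := by
  rw [transfer, iterRel_succ, psi_sigma, hom_eq_one_of_mem _ (iterRel_mem n), toAdd_one, zpow_zero,
    IsInvariantChar.map_one hf, add_zero]

/-- The n-th character is the n-fold `transfer` of the nilpotent one: each transfer shifts the
values along the relators by one place and inserts a 0 at the start. -/
theorem exists_char (n : ℕ) : ∃ f, IsInvariantChar toG f ∧ f (iterRel n) ≠ 0 ∧
    ∀ m < n, f (iterRel m) = 0 := by
  induction n with
  | zero => exact ⟨_, isInvariantChar_toNil, toNil_rel, fun m hm => absurd hm m.not_lt_zero⟩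
  | succ n ih =>
    obtain ⟨f, hf, hn, hlt⟩ := ih
    refine ⟨transfer f, isInvariantChar_transfer hf, ?_, fun m hm => ?_⟩
    · rwa [transfer_iterRel_succ hf]
    · cases m with
      | zero => exact transfer_iterRel_zero hf
      | succ m =>
        rw [transfer_iterRel_succ hf]
        exact hlt m (by omega)

theorem eq_zero_of_char_eq_zero (c : ℕ →₀ ℤ)
    (h : ∀ f, IsInvariantChar toG f → (c.sum fun i m => m * f (iterRel i)) = 0) : c = 0 := by
  by_contra hc
  have hne : c.support.Nonempty := Finsupp.support_nonempty_iff.2 hc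
  -- The character belonging to the largest index in the support kills all other terms of the sum.
  obtain ⟨f, hf, hN, hlt⟩ := exists_char (c.support.max' hne)
  have hmem := c.support.max'_mem hne
  have := h f hf
  rw [Finsupp.sum, Finset.sum_eq_single_of_mem _ hmem fun m hm hne' => ?_] at this
  · exact (mul_ne_zero (Finsupp.mem_support_iff.1 hmem) hN) this
  · rw [hlt m (lt_of_le_of_ne (c.support.le_max' m hm) hne'), mul_zero]

theorem nonempty_basis_schurMultiplier : Nonempty (Module.Basis ℕ ℤ (SchurMultiplier G)) := by
  refine nonempty_basis_H2 toG toG_surjective (fun v hv => ?_) (r := iterRel) ?_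
    eq_zero_of_char_eq_zero
  · have h : Abelianization.of v = 1 :=
      hom_eq_one_of_mem Abelianization.of (toG_eq_one_iff.1 hv)
    rwa [← MonoidHom.mem_ker, Abelianization.ker_of] at h
  · rw [ker_toG, relSub, relators_eq]

end Basilica

theorem mainTheorem3 :
    (∃ e : PresentedGroup Basilica.relators ≃* Basilica.G,
      e (PresentedGroup.of 0) = Basilica.genA ∧ e (PresentedGroup.of 1) = Basilica.genB) ∧
    (∃ L : Basilica.LPresentation (Fin 2), L.IsFinite ∧ L.relators = Basilica.relators) ∧
    (Module.Free ℤ (Basilica.SchurMultiplier Basilica.G) ∧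
      Cardinal.aleph0 ≤ Module.rank ℤ (Basilica.SchurMultiplier Basilica.G)) := by
  refine ⟨⟨Basilica.presentationEquiv, ?_, ?_⟩, Basilica.exists_finite_LPresentation, ?_⟩
  · exact Basilica.liftPair_freeA _ _
  · exact Basilica.liftPair_freeB _ _
  · obtain ⟨B⟩ := Basilica.nonempty_basis_schurMultiplier
    refine ⟨Module.Free.of_basis B, ?_⟩
    rw [← B.mk_eq_rank'', Cardinal.mk_nat]
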